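/- Let $(M,g)$ be a smooth finite-dimensional Riemannian manifold (without boundary), let $X$ be a vector field on $M$, and let $V\to M$ be a smooth real vector bundle of finite rank with a smooth fibre metric, also denoted $g$, and a smooth connection $\nabla$ compatible with it (for example, any tensor bundle over $M$ with the metric and the Riemannian connection induced by $g$). For a smooth section $T$ of $\mathrm{End}(V)$ let $\nabla T$ be its covariant derivative for the induced connection, $(\nabla_Y T)(s)=\nabla_Y(T(s))-T(\nabla_Y s)$, and let $$\Delta_X T=\sum_i \nabla^2_{E_i,E_i}T-\nabla_X T,\qquad \nabla^2_{Y,Z}T=\nabla_Y(\nabla_Z T)-\nabla_{\nabla_Y Z}T,$$ where $(E_i)$ is an orthonormal basis of the tangent space and $\nabla_Y Z$ is the Levi-Civita connection of $(M,g)$. Suppose that $T$ is symmetric ($g(T(s),t)=g(s,T(t))$ for all $s,t\in V_x$), nonnegative ($g(T(s),s)\ge 0$ for all $s\in V_x$), and of constant rank, and that $$g\big((\Delta_X T)(s),s\big)\le 0\qquad\text{for all } x\in M \text{ and all } s\in\ker T_x\subseteq V_x .$$ Then $\ker T$ is a parallel subbundle of $V$: the spaces $\ker T_x$ form a smooth vector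 subbundle of $V$, and for every smooth section $s$ of $\ker T$ over an open subset of $M$ and every tangent vector $u$ at a point of that subset, $\nabla_u s\in\ker T$. -/

import Mathlib

open Bundle Manifold
open scoped ContDiff Topology

set_option linter.unusedSectionVars false

noncomputable section HomConnection

variable
  {E : Type*} [NormedAddCommGroup E] [NormedSpace ℝ E] [FiniteDimensional ℝ E]
  {H : Type*} [TopologicalSpace H] {I : ModelWithCorners ℝ E H}
  {M : Type*} [TopologicalSpace M] [ChartedSpace H M] [IsManifold I 2 M]
  {F : Type*} [NormedAddCommGroup F] [NormedSpace ℝ F] [FiniteDimensional ℝ F]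
  {V : M → Type*} [TopologicalSpace (TotalSpace F V)]
  [∀ x, AddCommGroup (V x)] [∀ x, Module ℝ (V x)] [∀ x, TopologicalSpace (V x)]
  [∀ x, IsTopologicalAddGroup (V x)] [∀ x, ContinuousSMul ℝ (V x)]
  [FiberBundle F V] [VectorBundle ℝ F V] [ContMDiffVectorBundle 1 F V I]
  {F' : Type*} [NormedAddCommGroup F'] [NormedSpace ℝ F'] [FiniteDimensional ℝ F']
  {W : M → Type*} [TopologicalSpace (TotalSpace F' W)]
  [∀ x, AddCommGroup (W x)] [∀ x, Module ℝ (W x)] [∀ x, TopologicalSpace (W x)]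
  [∀ x, IsTopologicalAddGroup (W x)] [∀ x, ContinuousSMul ℝ (W x)]
  [FiberBundle F' W] [VectorBundle ℝ F' W] [ContMDiffVectorBundle 1 F' W I]

/-- The expression `∇_Y (A σ) - A (∇_Y σ)` at the point `x`. -/
def homCovAux (covV : CovariantDerivative I F V) (covW : CovariantDerivative I F' W)
    (A : Π x : M, V x →L[ℝ] W x) (x : M)
    (Y : Π x : M, TangentSpace I x) (σ : Π x : M, V x) : W x :=
  covW (fun y ↦ A y (σ y)) x (Y x) - A x (covV σ x (Y x))

theorem homCovAux_tensorial_left (covV : CovariantDerivative I F V)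
    (covW : CovariantDerivative I F' W) (A : Π x : M, V x →L[ℝ] W x) (x : M)
    (σ : Π x : M, V x) :
    TensorialAt I E (homCovAux covV covW A x · σ) x where
  smul _ _ := by simp [homCovAux, smul_sub]
  add _ _ := by simp only [homCovAux, Pi.add_apply, map_add]; abel

theorem homCovAux_tensorial_right (covV : CovariantDerivative I F V)
    (covW : CovariantDerivative I F' W) {A : Π x : M, V x →L[ℝ] W x} {x : M}
    (hA : MDifferentiableAt I (I.prod 𝓘(ℝ, F →L[ℝ] F'))
      (fun y ↦ TotalSpace.mk' (F →L[ℝ] F') (E := fun y ↦ V y →L[ℝ] W y) y (A y)) x)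
    (Y : Π x : M, TangentSpace I x) :
    TensorialAt I F (homCovAux covV covW A x Y) x where
  smul {f σ} hf hσ := by
    have h : (fun y ↦ A y ((f • σ) y)) = f • (fun y ↦ A y (σ y)) := by
      ext y; simp
    simp only [homCovAux, h]
    rw [covV.isCovariantDerivativeOnUniv.leibniz hσ hf,
      covW.isCovariantDerivativeOnUniv.leibniz (hA.clm_bundle_apply hσ) hf]
    simp [smul_sub]
  add {σ σ'} hσ hσ' := by
    have h : (fun y ↦ A y ((σ + σ') y)) = (fun y ↦ A y (σ y)) + (fun y ↦ A y (σ' y)) := by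
      ext y; simp
    simp only [homCovAux, h]
    rw [covV.isCovariantDerivativeOnUniv.add hσ hσ',
      covW.isCovariantDerivativeOnUniv.add (hA.clm_bundle_apply hσ) (hA.clm_bundle_apply hσ')]
    simp only [add_apply, map_add]
    abel

open scoped Classical in
/-- The underlying map of the induced connection on `Hom(V, W)`, characterized at a section `A`
differentiable at `x` by `(∇_Y A) σ = ∇_Y (A σ) - A (∇_Y σ)` (see `homCov_apply`); its value
where `A` is not differentiable is irrelevant and set to zero. -/
def homCov (covV : CovariantDerivative I F V) (covW : CovariantDerivative I F' W)
    (A : Π x : M, V x →L[ℝ] W x) (x : M) : TangentSpace I x →L[ℝ] (V x →L[ℝ] W x) :=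
  if hA : MDifferentiableAt I (I.prod 𝓘(ℝ, F →L[ℝ] F'))
      (fun y ↦ TotalSpace.mk' (F →L[ℝ] F') (E := fun y ↦ V y →L[ℝ] W y) y (A y)) x then
    TensorialAt.mkHom₂ (I := I) (F := E) (F' := F) (V := fun x : M ↦ TangentSpace I x)
      (homCovAux covV covW A x) x
      (fun σ _ ↦ homCovAux_tensorial_left covV covW A x σ)
      (fun Y _ ↦ homCovAux_tensorial_right covV covW hA Y)
  else 0

theorem homCov_apply (covV : CovariantDerivative I F V) (covW : CovariantDerivative I F' W)
    {A : Π x : M, V x →L[ℝ] W x} {x : M}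
    (hA : MDifferentiableAt I (I.prod 𝓘(ℝ, F →L[ℝ] F'))
      (fun y ↦ TotalSpace.mk' (F →L[ℝ] F') (E := fun y ↦ V y →L[ℝ] W y) y (A y)) x)
    {σ : Π x : M, V x}
    (hσ : MDifferentiableAt I (I.prod 𝓘(ℝ, F)) (fun y ↦ TotalSpace.mk' F y (σ y)) x)
    (u : TangentSpace I x) :
    homCov covV covW A x u (σ x) = covW (fun y ↦ A y (σ y)) x u - A x (covV σ x u) := by
  rw [homCov, dif_pos hA, TensorialAt.mkHom₂_apply_eq_extend]
  rw [(homCovAux_tensorial_right covV covW hA _).pointwise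
    (FiberBundle.mdifferentiableAt_extend ..) hσ (by simp)]
  simp [homCovAux]

/-- The connection on the bundle `Hom(V, W)` induced by connections on `V` and `W`. -/
def CovariantDerivative.hom (covV : CovariantDerivative I F V)
    (covW : CovariantDerivative I F' W) :
    CovariantDerivative I (F →L[ℝ] F') (fun x : M ↦ V x →L[ℝ] W x) where
  toFun := homCov covV covW
  isCovariantDerivativeOnUniv :=
    { add := by
        intro A B x hA hB _
        have hAB := mdifferentiableAt_add_section hA hB
        ext u v
        have hσ := FiberBundle.mdifferentiableAt_extend I F v
        have h := homCov_apply covV covW hAB hσ u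
        have hA' := homCov_apply covV covW hA hσ u
        have hB' := homCov_apply covV covW hB hσ u
        have e : (fun y ↦ (A + B) y (FiberBundle.extend F v y))
            = (fun y ↦ A y (FiberBundle.extend F v y))
              + (fun y ↦ B y (FiberBundle.extend F v y)) := by
          ext y; simp
        have hadd := covW.isCovariantDerivativeOnUniv.add
          (hA.clm_bundle_apply hσ) (hB.clm_bundle_apply hσ) (Set.mem_univ x)
        have hadd' : covW (fun y ↦ (A + B) y (FiberBundle.extend F v y)) x u = _ :=
          (congrArg (fun φ ↦ φ x u) (congrArg covW.toFun e)).trans (congrArg (· u) hadd)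
        simp only [FiberBundle.extend_apply_self] at h hA' hB'
        refine h.trans ?_
        rw [hadd']
        simp only [add_apply, Pi.add_apply, hA', hB']
        abel
      leibniz := by
        intro A g x hA hg _
        have hgA := hg.smul_section hA
        ext u v
        have hσ := FiberBundle.mdifferentiableAt_extend I F v
        have h := homCov_apply covV covW hgA hσ u
        have hA' := homCov_apply covV covW hA hσ u
        have e : (fun y ↦ (g • A) y (FiberBundle.extend F v y))
            = g • (fun y ↦ A y (FiberBundle.extend F v y)) := by
          ext y; simp
        have hlei := covW.isCovariantDerivativeOnUniv.leibniz
          (hA.clm_bundle_apply hσ) hg (Set.mem_univ x)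
        have hlei' : covW (fun y ↦ (g • A) y (FiberBundle.extend F v y)) x u = _ :=
          (congrArg (fun φ ↦ φ x u) (congrArg covW.toFun e)).trans (congrArg (· u) hlei)
        simp only [FiberBundle.extend_apply_self] at h hA'
        refine h.trans ?_
        rw [hlei']
        simp [hA', smul_sub]
        abel }

end HomConnection

section LeviCivita

variable
  {E : Type*} [NormedAddCommGroup E] [NormedSpace ℝ E] [FiniteDimensional ℝ E]
  {H : Type*} [TopologicalSpace H] {I : ModelWithCorners ℝ E H}
  {M : Type*} [TopologicalSpace M] [ChartedSpace H M] [IsManifold I ∞ M]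
  [RiemannianBundle (fun x : M ↦ TangentSpace I x)]
  [IsContMDiffRiemannianBundle I ∞ E (fun x : M ↦ TangentSpace I x)]

/-- The Levi-Civita (Riemannian) connection of a Riemannian manifold: the connection on the
tangent bundle that is compatible with the metric and torsion-free. -/
structure IsLeviCivita (covM : CovariantDerivative I E (fun x : M ↦ TangentSpace I x)) : Prop where
  metric : CovariantDerivative.IsMetricCompatible (V := fun x : M ↦ TangentSpace I x) covM
  torsion_free : covM.torsion = 0

end LeviCivita

noncomputable section Laplacian

variable
  {E : Type*} [NormedAddCommGroup E] [NormedSpace ℝ E] [FiniteDimensional ℝ E]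
  {H : Type*} [TopologicalSpace H] {I : ModelWithCorners ℝ E H}
  {M : Type*} [TopologicalSpace M] [ChartedSpace H M] [IsManifold I 2 M]
  [RiemannianBundle (fun x : M ↦ TangentSpace I x)]
  {F : Type*} [NormedAddCommGroup F] [NormedSpace ℝ F] [FiniteDimensional ℝ F]
  {W : M → Type*} [TopologicalSpace (TotalSpace F W)]
  [∀ x, AddCommGroup (W x)] [∀ x, Module ℝ (W x)] [∀ x, TopologicalSpace (W x)]
  [∀ x, IsTopologicalAddGroup (W x)] [∀ x, ContinuousSMul ℝ (W x)]
  [FiberBundle F W] [VectorBundle ℝ F W] [ContMDiffVectorBundle 1 F W I]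

/-- The second covariant derivative `∇²_{u,w} τ = ∇_u (∇_w τ) - ∇_{∇_u w} τ` of a section `τ`
of a bundle `W` with connection `covW`, where `covM` is the connection used on the tangent
bundle: the covariant derivative of the section `∇ τ` of `Hom(TM, W)`. -/
def secondCovDeriv (covM : CovariantDerivative I E (fun x : M ↦ TangentSpace I x))
    (covW : CovariantDerivative I F W) (τ : Π x : M, W x) (x : M) :
    TangentSpace I x →L[ℝ] TangentSpace I x →L[ℝ] W x :=
  (covM.hom covW) (covW τ) x

instance finiteDimensional_tangentSpace (x : M) : FiniteDimensional ℝ (TangentSpace I x) :=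
  inferInstanceAs (FiniteDimensional ℝ E)

/-- The connection Laplacian `Δ τ = ∑ᵢ ∇²_{eᵢ,eᵢ} τ`, where `(eᵢ)` is an orthonormal basis
of the tangent space. -/
def connLaplacian (covM : CovariantDerivative I E (fun x : M ↦ TangentSpace I x))
    (covW : CovariantDerivative I F W) (τ : Π x : M, W x) (x : M) : W x :=
  ∑ i, secondCovDeriv covM covW τ x (stdOrthonormalBasis ℝ (TangentSpace I x) i)
    (stdOrthonormalBasis ℝ (TangentSpace I x) i)

/-- The connection Laplacian does not depend on the orthonormal basis. -/
theorem connLaplacian_eq_sum (covM : CovariantDerivative I E (fun x : M ↦ TangentSpace I x))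
    (covW : CovariantDerivative I F W) (τ : Π x : M, W x) (x : M)
    {ι : Type*} [Fintype ι] (b : OrthonormalBasis ι ℝ (TangentSpace I x)) :
    connLaplacian covM covW τ x = ∑ i, secondCovDeriv covM covW τ x (b i) (b i) := by
  classical
  have key : ∀ B : TangentSpace I x →ₗ[ℝ] TangentSpace I x →ₗ[ℝ] W x,
      ∀ {κ : Type} [Fintype κ] (e : OrthonormalBasis κ ℝ (TangentSpace I x)),
        ∑ j, B (e j) (e j) = ∑ i, B (b i) (b i) := by
    intro B κ _ e
    classical
    have expand : ∀ i, B (b i) (b i) =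
        ∑ j, ∑ k, (inner ℝ (e j) (b i) * inner ℝ (b i) (e k)) • B (e j) (e k) := by
      intro i
      conv_lhs => rw [← e.sum_repr' (b i)]
      simp only [map_sum, map_smul, LinearMap.sum_apply, LinearMap.smul_apply,
        Finset.smul_sum, smul_smul]
      rw [Finset.sum_comm]
      simp only [real_inner_comm (b i), mul_comm]
    simp_rw [expand]
    rw [Finset.sum_comm]
    refine Finset.sum_congr rfl fun j _ ↦ ?_
    rw [Finset.sum_comm]
    simp_rw [← Finset.sum_smul, b.sum_inner_mul_inner, e.inner_eq_ite]
    simp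
  let B : TangentSpace I x →ₗ[ℝ] TangentSpace I x →ₗ[ℝ] W x :=
    (ContinuousLinearMap.coeLM ℝ).comp (secondCovDeriv covM covW τ x).toLinearMap
  exact key B (stdOrthonormalBasis ℝ (TangentSpace I x))

/-- The `X`-Laplacian `Δ_X τ = Δ τ - ∇_X τ`. -/
def XLaplacian (covM : CovariantDerivative I E (fun x : M ↦ TangentSpace I x))
    (covW : CovariantDerivative I F W) (X : Π x : M, TangentSpace I x) (τ : Π x : M, W x)
    (x : M) : W x :=
  connLaplacian covM covW τ x - covW τ x (X x)

end Laplacian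

section Subbundle

variable
  {E : Type*} [NormedAddCommGroup E] [NormedSpace ℝ E]
  {H : Type*} [TopologicalSpace H] (I : ModelWithCorners ℝ E H)
  {M : Type*} [TopologicalSpace M] [ChartedSpace H M]
  (F : Type*) [NormedAddCommGroup F] [NormedSpace ℝ F]
  {V : M → Type*} [TopologicalSpace (TotalSpace F V)]
  [∀ x, AddCommGroup (V x)] [∀ x, Module ℝ (V x)] [∀ x, TopologicalSpace (V x)]
  [∀ x, IsTopologicalAddGroup (V x)] [∀ x, ContinuousSMul ℝ (V x)]
  [FiberBundle F V]

/-- A family of subspaces `S x ⊆ V x` is a smooth subbundle (of some rank `r`) if near every point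
there are `r` smooth local sections of `V` whose values form a basis of `S y` for all nearby `y`. -/
def IsSmoothSubbundle (S : Π x : M, Submodule ℝ (V x)) : Prop :=
  ∃ r : ℕ, ∀ x : M, ∃ U : Set M, IsOpen U ∧ x ∈ U ∧ ∃ σ : Fin r → Π y : M, V y,
    (∀ i, ContMDiffOn I (I.prod 𝓘(ℝ, F)) ∞ (fun y ↦ TotalSpace.mk' F y (σ i y)) U) ∧
    ∀ y ∈ U, LinearIndependent ℝ (fun i ↦ σ i y) ∧
      Submodule.span ℝ (Set.range fun i ↦ σ i y) = S y

variable {I F}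

/-- A family of subspaces `S x ⊆ V x` is parallel for a connection `∇` on `V` if `∇_u σ` lies in
`S` for every smooth local section `σ` of `V` with values in `S` and every tangent vector `u`. -/
def IsParallelSubspace (cov : CovariantDerivative I F V) (S : Π x : M, Submodule ℝ (V x)) :
    Prop :=
  ∀ (U : Set M) (σ : Π x : M, V x), IsOpen U →
    ContMDiffOn I (I.prod 𝓘(ℝ, F)) ∞ (fun y ↦ TotalSpace.mk' F y (σ y)) U →
    (∀ y ∈ U, σ y ∈ S y) → ∀ x ∈ U, ∀ u : TangentSpace I x, cov σ x u ∈ S x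

end Subbundle

/-! ### Extending local sections to global ones; testing differentiability on sections -/

section GlobalSections

variable
  {E : Type*} [NormedAddCommGroup E] [NormedSpace ℝ E] [FiniteDimensional ℝ E]
  {H : Type*} [TopologicalSpace H] {I : ModelWithCorners ℝ E H}
  {M : Type*} [TopologicalSpace M] [T2Space M] [ChartedSpace H M] [IsManifold I ∞ M]

/-! Let `σ` be a section with `T σ = 0`. Differentiating gives `(∇_u T) σ = -T (∇_u σ)`, which is
orthogonal to `σ` because `T` is symmetric and kills `σ`. Differentiating once more and pairing with
`σ` gives `⟪(∇²_{u,u} T) σ, σ⟫ = 2 ⟪T (∇_u σ), ∇_u σ⟫` (`inner_secondCovDeriv_of_apply_eq_zero`).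

Summed over an orthonormal basis, with the term `∇_X T` contributing nothing, the hypothesis on `Δ_X
T` says that a sum of nonnegative numbers is at most zero. Each summand therefore vanishes, and
Cauchy–Schwarz for the form `⟪T ·, ·⟫` yields `T (∇_u σ) = 0`. This is a pointwise argument: no
maximum principle enters.

Smoothness of the kernel is separate and uses constant rank: near `x` an invertible, smoothly
varying operator carries `ker T_y` onto `ker T_x` in a trivialization, and its inverse transports a
basis of `ker T_x` to a smooth frame (`exists_smooth_frame_ker`). -/

theorem exists_contMDiff_bump (x : M) {U : Set M} (hU : IsOpen U) (hx : x ∈ U) :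
    ∃ f : M → ℝ, ContMDiff I 𝓘(ℝ, ℝ) ∞ f ∧ f =ᶠ[𝓝 x] 1 ∧ tsupport f ⊆ U := by
  obtain ⟨f, -, hf⟩ := (SmoothBumpFunction.nhds_basis_tsupport (I := I) x).mem_iff.1 (hU.mem_nhds hx)
  exact ⟨f, f.contMDiff, f.eventuallyEq_one, hf⟩

variable
  {F : Type*} [NormedAddCommGroup F] [NormedSpace ℝ F]
  {V : M → Type*} [TopologicalSpace (TotalSpace F V)]
  [∀ x, AddCommGroup (V x)] [∀ x, Module ℝ (V x)] [∀ x, TopologicalSpace (V x)]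
  [FiberBundle F V] [VectorBundle ℝ F V]

/-- A smooth local section agrees near each point of its domain with a global smooth section,
obtained from it by multiplication with a function vanishing off the domain. -/
theorem exists_contMDiff_section_eventuallyEq [ContMDiffVectorBundle ∞ F V I]
    {x : M} {U : Set M} (hU : IsOpen U) (hx : x ∈ U)
    {σ : Π y : M, V y}
    (hσ : ContMDiffOn I (I.prod 𝓘(ℝ, F)) ∞ (fun y ↦ TotalSpace.mk' F y (σ y)) U) :
    ∃ f : M → ℝ, ContMDiff I (I.prod 𝓘(ℝ, F)) ∞ (fun y ↦ TotalSpace.mk' F y ((f • σ) y)) ∧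
      (∀ᶠ y in 𝓝 x, (f • σ) y = σ y) ∧ ∀ y ∉ U, f y = 0 := by
  obtain ⟨f, hf, hf1, hfU⟩ := exists_contMDiff_bump (I := I) x hU hx
  refine ⟨f, ContMDiffOn.smul_section_of_tsupport hf.contMDiffOn hU hfU hσ, ?_, ?_⟩
  · filter_upwards [hf1] with y hy
    simp [hy]
  · intro y hy
    exact image_eq_zero_of_notMem_tsupport fun h ↦ hy (hfU h)

/-- Supplies global sections that are constant in the trivialization near `x`, so that they read off
the columns of a bundle map. -/
theorem exists_contMDiff_section_eventuallyEq_symm [ContMDiffVectorBundle ∞ F V I]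
    (x : M) (v : F) :
    ∃ σ : Π y : M, V y, ContMDiff I (I.prod 𝓘(ℝ, F)) ∞ (fun y ↦ TotalSpace.mk' F y (σ y)) ∧
      ∀ᶠ y in 𝓝 x, σ y = (trivializationAt F V x).symm y v := by
  set e := trivializationAt F V x
  have h : ContMDiffOn I (I.prod 𝓘(ℝ, F)) ∞ (fun y ↦ TotalSpace.mk' F y (e.symm y v))
      e.baseSet := by
    rw [e.contMDiffOn_section_baseSet_iff]
    refine contMDiffOn_const (c := v) |>.congr fun y hy ↦ ?_
    rw [e.apply_mk_symm hy]
  obtain ⟨f, hf, hf1, -⟩ := exists_contMDiff_section_eventuallyEq e.open_baseSet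
    (FiberBundle.mem_baseSet_trivializationAt' x) h
  exact ⟨_, hf, hf1⟩

variable
  [FiniteDimensional ℝ F]
  [∀ x, IsTopologicalAddGroup (V x)] [∀ x, ContinuousSMul ℝ (V x)]
  {F' : Type*} [NormedAddCommGroup F'] [NormedSpace ℝ F']
  {W : M → Type*} [TopologicalSpace (TotalSpace F' W)]
  [∀ x, AddCommGroup (W x)] [∀ x, Module ℝ (W x)] [∀ x, TopologicalSpace (W x)]
  [∀ x, IsTopologicalAddGroup (W x)] [∀ x, ContinuousSMul ℝ (W x)]
  [FiberBundle F' W] [VectorBundle ℝ F' W]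

/-- The map `Φ y` is a finite sum of rank-one maps, each a fixed continuous linear function of one
column `Φ y (b i)`. -/
theorem mdifferentiableAt_clm_of_basis {G : Type*} [NormedAddCommGroup G] [NormedSpace ℝ G]
    {ι : Type*} [Fintype ι] (b : Module.Basis ι ℝ F) {Φ : M → F →L[ℝ] G} {x : M}
    (h : ∀ i, MDifferentiableAt I 𝓘(ℝ, G) (fun y ↦ Φ y (b i)) x) :
    MDifferentiableAt I 𝓘(ℝ, F →L[ℝ] G) Φ x := by
  have key : ∀ y, Φ y = ∑ i, ContinuousLinearMap.smulRightL ℝ F G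
      (LinearMap.toContinuousLinearMap (b.coord i)) (Φ y (b i)) := by
    intro y
    refine ContinuousLinearMap.coe_injective (b.ext fun j ↦ ?_)
    classical
    simp [Finsupp.single_apply, ite_smul]
  rw [show Φ = _ from funext key]
  have : ∀ i, MDifferentiableAt I 𝓘(ℝ, F →L[ℝ] G) (fun y ↦ ContinuousLinearMap.smulRightL ℝ F G
      (LinearMap.toContinuousLinearMap (b.coord i)) (Φ y (b i))) x := fun i ↦
    (ContinuousLinearMap.mdifferentiableAt _).comp x (h i)
  classical
  induction (Finset.univ : Finset ι) using Finset.induction_on with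
  | empty => simpa using mdifferentiableAt_const
  | insert i s hi ih => simpa [Finset.sum_insert hi] using! (this i).add ih

/-- A section of `Hom(V, W)` is differentiable at `x` if its values on global smooth sections
of `V` are. -/
theorem mdifferentiableAt_hom_of_apply [ContMDiffVectorBundle ∞ F V I]
    {A : Π x : M, V x →L[ℝ] W x} {x : M}
    (h : ∀ σ : Π y : M, V y, ContMDiff I (I.prod 𝓘(ℝ, F)) ∞ (fun y ↦ TotalSpace.mk' F y (σ y)) →
      MDifferentiableAt I (I.prod 𝓘(ℝ, F')) (fun y ↦ TotalSpace.mk' F' y (A y (σ y))) x) :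
    MDifferentiableAt I (I.prod 𝓘(ℝ, F →L[ℝ] F'))
      (fun y ↦ TotalSpace.mk' (F →L[ℝ] F') (E := fun y ↦ V y →L[ℝ] W y) y (A y)) x := by
  rw [mdifferentiableAt_hom_bundle]
  refine ⟨mdifferentiableAt_id, ?_⟩
  refine mdifferentiableAt_clm_of_basis (Module.finBasis ℝ F) fun i ↦ ?_
  -- Near `x`, the `i`-th column of the coordinate matrix of `A` is the coordinate vector of `A σ`.
  obtain ⟨σ, hσ, hσe⟩ := exists_contMDiff_section_eventuallyEq_symm (I := I) (V := V) x
    (Module.finBasis ℝ F i)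
  have hA := (mdifferentiableAt_totalSpace I _).1 (h σ hσ)
  refine hA.2.congr_of_eventuallyEq ?_
  have h1 := (trivializationAt F V x).open_baseSet.mem_nhds
    (FiberBundle.mem_baseSet_trivializationAt' (F := F) (E := V) x)
  have h2 := (trivializationAt F' W x).open_baseSet.mem_nhds
    (FiberBundle.mem_baseSet_trivializationAt' (F := F') (E := W) x)
  filter_upwards [hσe, h1, h2] with y hy h1 h2
  simp [ContinuousLinearMap.inCoordinates, hy, h1, h2,
    Bundle.Trivialization.symmL_apply, Bundle.Trivialization.coe_linearMapAt_of_mem]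

end GlobalSections

/-! ### Regularity of the induced connection -/

section HomConnectionSmooth

variable
  {E : Type*} [NormedAddCommGroup E] [NormedSpace ℝ E] [FiniteDimensional ℝ E]
  {H : Type*} [TopologicalSpace H] {I : ModelWithCorners ℝ E H}
  {M : Type*} [TopologicalSpace M] [T2Space M] [ChartedSpace H M] [IsManifold I ∞ M]
  {F : Type*} [NormedAddCommGroup F] [NormedSpace ℝ F] [FiniteDimensional ℝ F]
  {V : M → Type*} [TopologicalSpace (TotalSpace F V)]
  [∀ x, AddCommGroup (V x)] [∀ x, Module ℝ (V x)] [∀ x, TopologicalSpace (V x)]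
  [∀ x, IsTopologicalAddGroup (V x)] [∀ x, ContinuousSMul ℝ (V x)]
  [FiberBundle F V] [VectorBundle ℝ F V] [ContMDiffVectorBundle ∞ F V I]
  {F' : Type*} [NormedAddCommGroup F'] [NormedSpace ℝ F'] [FiniteDimensional ℝ F']
  {W : M → Type*} [TopologicalSpace (TotalSpace F' W)]
  [∀ x, AddCommGroup (W x)] [∀ x, Module ℝ (W x)] [∀ x, TopologicalSpace (W x)]
  [∀ x, IsTopologicalAddGroup (W x)] [∀ x, ContinuousSMul ℝ (W x)]
  [FiberBundle F' W] [VectorBundle ℝ F' W] [ContMDiffVectorBundle ∞ F' W I]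

theorem CovariantDerivative.mdifferentiableAt_of_contMDiff
    (cov : CovariantDerivative I F V) [cov.ContMDiffCovariantDerivative ∞]
    {σ : Π y : M, V y} (hσ : ContMDiff I (I.prod 𝓘(ℝ, F)) ∞ (fun y ↦ TotalSpace.mk' F y (σ y)))
    (x : M) :
    MDifferentiableAt I (I.prod 𝓘(ℝ, E →L[ℝ] F)) (fun y ↦ TotalSpace.mk' (E →L[ℝ] F)
      (E := fun y ↦ TangentSpace I y →L[ℝ] V y) y (cov σ y)) x := by
  have h := (CovariantDerivative.ContMDiffCovariantDerivative.contMDiff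
    (cov := cov) (k := ∞)).contMDiff (σ := σ) (by simpa using! hσ.contMDiffOn)
  exact (contMDiffOn_univ.1 h x).mdifferentiableAt (by simp)

/-- The induced connection on `Hom(V, W)` maps smooth sections to differentiable ones. -/
theorem mdifferentiableAt_homCov (covV : CovariantDerivative I F V)
    [covV.ContMDiffCovariantDerivative ∞] (covW : CovariantDerivative I F' W)
    [covW.ContMDiffCovariantDerivative ∞] {A : Π x : M, V x →L[ℝ] W x}
    (hA : ContMDiff I (I.prod 𝓘(ℝ, F →L[ℝ] F')) ∞
      (fun x ↦ TotalSpace.mk' (F →L[ℝ] F') (E := fun x ↦ V x →L[ℝ] W x) x (A x))) (x : M) :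
    MDifferentiableAt I (I.prod 𝓘(ℝ, E →L[ℝ] F →L[ℝ] F'))
      (fun y ↦ TotalSpace.mk' (E →L[ℝ] F →L[ℝ] F')
        (E := fun y ↦ TangentSpace I y →L[ℝ] V y →L[ℝ] W y) y (covV.hom covW A y)) x := by
  -- Testing on a vector field and then on a section reduces the claim to the Leibniz formula, whose
  -- two terms are differentiable.
  refine mdifferentiableAt_hom_of_apply fun Y hY ↦ mdifferentiableAt_hom_of_apply fun σ hσ ↦ ?_
  have hY' := (hY x).mdifferentiableAt (by simp)
  have e : ∀ y, covV.hom covW A y (Y y) (σ y) =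
      covW (fun z ↦ A z (σ z)) y (Y y) - A y (covV σ y (Y y)) := fun y ↦
    homCov_apply covV covW ((hA y).mdifferentiableAt (by simp))
      ((hσ y).mdifferentiableAt (by simp)) (Y y)
  simp only [e]
  refine mdifferentiableAt_sub_section ?_ ?_
  · exact (covW.mdifferentiableAt_of_contMDiff (hA.clm_bundle_apply hσ) x).clm_bundle_apply hY'
  · exact ((hA x).mdifferentiableAt (by simp)).clm_bundle_apply
      ((covV.mdifferentiableAt_of_contMDiff hσ x).clm_bundle_apply hY')

end HomConnectionSmooth

/-! ### The second derivative of `T` on its kernel, and parallelism -/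

section Kernel

/-- Cauchy–Schwarz for a nonnegative symmetric operator: `⟪T v, v⟫ = 0` forces `T v = 0`. -/
theorem apply_eq_zero_of_inner_self_eq_zero {V : Type*} [NormedAddCommGroup V]
    [InnerProductSpace ℝ V] {T : V →L[ℝ] V}
    (hT : ∀ v w, inner ℝ (T v) w = inner ℝ v (T w)) (h0 : ∀ v, 0 ≤ inner ℝ (T v) v) {v : V}
    (hv : inner ℝ (T v) v ≤ 0) : T v = 0 := by
  have hvv : inner ℝ (T v) v = 0 := le_antisymm hv (h0 v)
  -- This is `⟪T (v + t T v), v + t T v⟫`. With no constant term, its discriminant is `4 ‖T v‖⁴`,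
  -- which must be nonpositive.
  have key : ∀ t : ℝ, 0 ≤ inner ℝ (T (T v)) (T v) * (t * t) + 2 * ‖T v‖ ^ 2 * t + 0 := by
    intro t
    have h := h0 (v + t • T v)
    simp only [map_add, map_smul, inner_add_left, inner_add_right, inner_smul_left,
      inner_smul_right, hvv, hT (T v) v, real_inner_self_eq_norm_sq, conj_trivial] at h
    linarith
  have h := discrim_le_zero key
  have : ‖T v‖ ^ 2 = 0 := by
    rw [discrim] at h
    nlinarith [sq_nonneg (‖T v‖ ^ 2)]
  simpa using this

variable
  {E : Type*} [NormedAddCommGroup E] [NormedSpace ℝ E] [FiniteDimensional ℝ E]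
  {H : Type*} [TopologicalSpace H] {I : ModelWithCorners ℝ E H}
  {M : Type*} [TopologicalSpace M] [T2Space M] [ChartedSpace H M] [IsManifold I ∞ M]
  {F : Type*} [NormedAddCommGroup F] [NormedSpace ℝ F] [FiniteDimensional ℝ F]
  {V : M → Type*} [TopologicalSpace (TotalSpace F V)]
  [∀ x, NormedAddCommGroup (V x)] [∀ x, InnerProductSpace ℝ (V x)]
  [FiberBundle F V] [VectorBundle ℝ F V] [ContMDiffVectorBundle ∞ F V I]
  [IsContMDiffRiemannianBundle I ∞ F V]

/-- For a metric connection, `⟪∇_u σ, τ⟫ = - ⟪σ, ∇_u τ⟫` if `σ` and `τ` are orthogonal. -/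
theorem CovariantDerivative.IsMetricCompatible.inner_eq_neg_of_orthogonal
    {nabla : CovariantDerivative I F V} (h_metric : nabla.IsMetricCompatible)
    {σ τ : Π x : M, V x} {x : M}
    (hσ : MDifferentiableAt I (I.prod 𝓘(ℝ, F)) (fun y ↦ TotalSpace.mk' F y (σ y)) x)
    (hτ : MDifferentiableAt I (I.prod 𝓘(ℝ, F)) (fun y ↦ TotalSpace.mk' F y (τ y)) x)
    (h : ∀ y, inner ℝ (σ y) (τ y) = 0) (u : TangentSpace I x) :
    inner ℝ (nabla σ x u) (τ x) = - inner ℝ (σ x) (nabla τ x u) := by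
  have H := h_metric.mvfderiv_inner_eq (FiberBundle.extend E u) hσ hτ
  simp only [FiberBundle.extend_apply_self, h] at H
  have h0 : mvfderiv I (fun _ : M ↦ (0 : ℝ)) x u = 0 := by
    simp [mvfderiv]
  linarith [H.symm.trans h0]

/-- On the kernel of `T`, `⟪(∇²_{u,u} T) σ, σ⟫ = 2 ⟪T (∇_u σ), ∇_u σ⟫`, where `σ` is a section
with `T σ = 0`. -/
theorem inner_secondCovDeriv_of_apply_eq_zero
    (nablaM : CovariantDerivative I E (fun x : M ↦ TangentSpace I x))
    (nabla : CovariantDerivative I F V) [nabla.ContMDiffCovariantDerivative ∞]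
    (h_metric : nabla.IsMetricCompatible)
    (T : Π x : M, V x →L[ℝ] V x)
    (hT_smooth : ContMDiff I (I.prod 𝓘(ℝ, F →L[ℝ] F)) ∞
      (fun x ↦ TotalSpace.mk' (F →L[ℝ] F) (E := fun x ↦ V x →L[ℝ] V x) x (T x)))
    (hT_symm : ∀ (x : M) (v w : V x), inner ℝ (T x v) w = inner ℝ v (T x w))
    {σ : Π x : M, V x}
    (hσ : ContMDiff I (I.prod 𝓘(ℝ, F)) ∞ (fun y ↦ TotalSpace.mk' F y (σ y)))
    (hTσ : ∀ y, T y (σ y) = 0) (x : M) (u : TangentSpace I x) :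
    inner ℝ (secondCovDeriv nablaM (nabla.hom nabla) T x u u (σ x)) (σ x) =
      2 * inner ℝ (T x (nabla σ x u)) (nabla σ x u) := by
  have dT := fun y ↦ (hT_smooth y).mdifferentiableAt (by simp)
  have dσ := fun y ↦ (hσ y).mdifferentiableAt (by simp)
  set D := nabla.hom nabla T with hD
  have dD := mdifferentiableAt_homCov nabla nabla hT_smooth x
  set Y : Π y : M, TangentSpace I y := FiberBundle.extend E u with hY
  have dY := FiberBundle.mdifferentiableAt_extend I E u
  have Yx : Y x = u := by simp [hY]
  have hker : ∀ (y : M) (v : V y), inner ℝ (T y v) (σ y) = 0 := fun y v ↦ by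
    rw [hT_symm, hTσ, inner_zero_right]
  -- The Leibniz rule applied to `T σ = 0`.
  have Dσ : ∀ (y : M) (z : TangentSpace I y), D y z (σ y) = - T y (nabla σ y z) := by
    intro y z
    refine (homCov_apply nabla nabla (dT y) (dσ y) z).trans ?_
    have : (fun y ↦ T y (σ y)) = 0 := funext hTσ
    simp [this]
  set w : Π y : M, V y := fun y ↦ nabla σ y (Y y) with hw
  have dw : MDifferentiableAt I (I.prod 𝓘(ℝ, F)) (fun y ↦ TotalSpace.mk' F y (w y)) x :=
    (nabla.mdifferentiableAt_of_contMDiff hσ x).clm_bundle_apply dY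
  have dTw : MDifferentiableAt I (I.prod 𝓘(ℝ, F))
    (fun y ↦ TotalSpace.mk' F y (T y (w y))) x := (dT x).clm_bundle_apply dw
  have wx : w x = nabla σ x u := by rw [hw]; simp only [Yx]
  -- `h1` to `h4` unfold the second derivative to `-2 ∇_u (T w)` plus values of `T`. The latter are
  -- orthogonal to `σ`, so neither `∇_u w` nor `∇_u Y`, which depend on the extension `Y`, survives
  -- the pairing with `σ`.
  have h1 : secondCovDeriv nablaM (nabla.hom nabla) T x u u =
      nabla.hom nabla (fun y ↦ D y (Y y)) x u - D x (nablaM Y x u) := by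
    have h : secondCovDeriv nablaM (nabla.hom nabla) T x u (Y x) =
        nabla.hom nabla (fun y ↦ D y (Y y)) x u - D x (nablaM Y x u) :=
      homCov_apply nablaM (nabla.hom nabla) dD dY u
    rwa [Yx] at h
  have h2 : nabla.hom nabla (fun y ↦ D y (Y y)) x u (σ x) =
      nabla (fun y ↦ D y (Y y) (σ y)) x u - D x (Y x) (nabla σ x u) :=
    homCov_apply nabla nabla (dD.clm_bundle_apply dY) (dσ x) u
  have h3 : nabla (fun y ↦ D y (Y y) (σ y)) x = - nabla (fun y ↦ T y (w y)) x := by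
    have e : (fun y ↦ D y (Y y) (σ y)) = (-1 : ℝ) • (fun y ↦ T y (w y)) := by
      funext y; simp [Dσ, hw]
    rw [e, nabla.isCovariantDerivativeOnUniv.smul_const _ dTw]
    simp
  have h4 : D x (Y x) (nabla σ x u) = nabla (fun y ↦ T y (w y)) x u - T x (nabla w x u) := by
    have := homCov_apply nabla nabla (dT x) dw u
    rw [Yx, ← wx]
    exact this
  -- Since `T w` is orthogonal to `σ` everywhere, metric compatibility moves the derivative onto
  -- `σ`.
  have h5 : inner ℝ (nabla (fun y ↦ T y (w y)) x u) (σ x) = - inner ℝ (T x (w x)) (w x) := by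
    rw [h_metric.inner_eq_neg_of_orthogonal dTw (dσ x) (fun y ↦ hker y _), wx]
  rw [h1, sub_apply, h2, h3, h4, neg_apply, Dσ]
  simp only [inner_sub_left, inner_neg_left, h5, hker, wx]
  ring

/-- On the kernel, `⟪(Δ_X T) σ, σ⟫` is twice the sum of the `⟪T (∇_{e_i} σ), ∇_{e_i} σ⟫`, so the
sign hypothesis forces every summand to vanish. -/
theorem isParallelSubspace_ker
    [RiemannianBundle (fun x : M ↦ TangentSpace I x)]
    (nablaM : CovariantDerivative I E (fun x : M ↦ TangentSpace I x))
    (nabla : CovariantDerivative I F V) [nabla.ContMDiffCovariantDerivative ∞]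
    (h_metric : nabla.IsMetricCompatible)
    (X : Π x : M, TangentSpace I x)
    (T : Π x : M, V x →L[ℝ] V x)
    (hT_smooth : ContMDiff I (I.prod 𝓘(ℝ, F →L[ℝ] F)) ∞
      (fun x ↦ TotalSpace.mk' (F →L[ℝ] F) (E := fun x ↦ V x →L[ℝ] V x) x (T x)))
    (hT_symm : ∀ (x : M) (v w : V x), inner ℝ (T x v) w = inner ℝ v (T x w))
    (hT_nonneg : ∀ (x : M) (v : V x), 0 ≤ inner ℝ (T x v) v)
    (hT_laplacian : ∀ (x : M) (v : V x), T x v = 0 →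
      inner ℝ (XLaplacian nablaM (nabla.hom nabla) X T x v) v ≤ 0) :
    IsParallelSubspace nabla (fun x ↦ LinearMap.ker (T x).toLinearMap) := by
  intro U σ₀ hU hσ₀ hker₀ x hx u
  -- The cut-off section lies in the kernel on all of `M`: off `U`, where `σ₀` is arbitrary, it is
  -- zero. By locality its derivative at `x` is unchanged.
  obtain ⟨f, hσ, heq, hfU⟩ := exists_contMDiff_section_eventuallyEq hU hx hσ₀
  set σ : Π y : M, V y := f • σ₀ with hσdef
  have hTσ : ∀ y, T y (σ y) = 0 := by
    intro y
    by_cases hy : y ∈ U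
    · have : T y (σ₀ y) = 0 := hker₀ y hy
      simp [hσdef, this]
    · simp [hσdef, hfU y hy]
  have hnabla : nabla σ₀ x = nabla σ x :=
    nabla.isCovariantDerivativeOnUniv.congr_of_eventuallyEq
      ((hσ₀.contMDiffAt (hU.mem_nhds hx)).mdifferentiableAt (by simp))
      ((hσ x).mdifferentiableAt (by simp)) Filter.univ_mem (heq.mono fun y hy ↦ hy.symm)
  rw [hnabla]
  have hsum := hT_laplacian x (σ x) (hTσ x)
  -- The drift term is `-T (∇_X σ)`, orthogonal to `σ` by symmetry.
  have hX : inner ℝ ((nabla.hom nabla) T x (X x) (σ x)) (σ x) = 0 := by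
    have h := homCov_apply nabla nabla ((hT_smooth x).mdifferentiableAt (by simp))
      ((hσ x).mdifferentiableAt (by simp)) (X x)
    have e : (fun y ↦ T y (σ y)) = 0 := funext hTσ
    have h' : (nabla.hom nabla) T x (X x) (σ x) = - T x (nabla σ x (X x)) := by
      refine h.trans ?_
      simp [e]
    rw [h', inner_neg_left, hT_symm, hTσ, inner_zero_right, neg_zero]
  set b := stdOrthonormalBasis ℝ (TangentSpace I x)
  have hsum' : ∑ i, inner ℝ (T x (nabla σ x (b i))) (nabla σ x (b i)) ≤ 0 := by
    rw [XLaplacian, connLaplacian, sub_apply, inner_sub_left, hX, sub_zero,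
      sum_apply, sum_inner] at hsum
    simp only [inner_secondCovDeriv_of_apply_eq_zero nablaM nabla h_metric T hT_smooth hT_symm hσ
      hTσ x, ← Finset.mul_sum] at hsum
    linarith
  have hz : ∀ i, T x (nabla σ x (b i)) = 0 := fun i ↦
    apply_eq_zero_of_inner_self_eq_zero (hT_symm x) (hT_nonneg x)
      ((Finset.single_le_sum (f := fun i ↦ inner ℝ (T x (nabla σ x (b i))) (nabla σ x (b i)))
        (fun i _ ↦ hT_nonneg x _) (Finset.mem_univ i)).trans hsum')
  have hcomp : (T x).toLinearMap ∘ₗ (nabla σ x).toLinearMap = 0 :=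
    b.toBasis.ext fun i ↦ by simpa using hz i
  exact LinearMap.congr_fun hcomp u

end Kernel

/-! ### Kernels of constant rank are smooth subbundles -/

section ConstantRank

/-- If `B = L A + P` is invertible, where the range of `P` lies in the span of linearly independent
vectors `n i` whose number is the nullity of `A`, then the vectors `B⁻¹ (n i)` span the kernel
of `A`. -/
theorem span_symm_eq_ker {F ι : Type*} [NormedAddCommGroup F] [NormedSpace ℝ F]
    [FiniteDimensional ℝ F] [Fintype ι] {A L P : F →L[ℝ] F}
    (B : F ≃L[ℝ] F) (hB : ∀ v, B v = L (A v) + P v) {n : ι → F}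
    (hli : LinearIndependent ℝ n)
    (hspan : ∀ v, P v ∈ Submodule.span ℝ (Set.range n))
    (hcard : Module.finrank ℝ (LinearMap.ker A.toLinearMap) = Fintype.card ι) :
    LinearIndependent ℝ (fun i ↦ B.symm (n i)) ∧
      Submodule.span ℝ (Set.range fun i ↦ B.symm (n i)) = LinearMap.ker A.toLinearMap := by
  have hli' : LinearIndependent ℝ (fun i ↦ B.symm (n i)) :=
    hli.map' B.symm.toLinearEquiv.toLinearMap B.symm.toLinearEquiv.ker
  refine ⟨hli', (Submodule.eq_of_le_of_finrank_eq ?_ ?_).symm⟩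
  · intro v hv
    have hv : A v = 0 := hv
    -- On `ker A` the operator `B` reduces to `P`; equality of dimensions then upgrades the
    -- inclusion.
    have hmem : B v ∈ Submodule.span ℝ (Set.range n) := by
      simpa [hB, hv] using hspan v
    have := Submodule.mem_map_of_mem (f := B.symm.toLinearEquiv.toLinearMap) hmem
    rw [Submodule.map_span, ← Set.range_comp] at this
    simpa [Function.comp_def] using! this
  · rw [hcard, finrank_span_eq_card hli']

/-- A linear map has a generalized inverse. -/
theorem LinearMap.exists_generalized_inverse {K V W : Type*} [DivisionRing K] [AddCommGroup V]
    [Module K V] [AddCommGroup W] [Module K W] (A : V →ₗ[K] W) :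
    ∃ C : W →ₗ[K] V, ∀ v, A (C (A v)) = A v := by
  -- Choose preimages linearly on the range of `A` and extend the choice to the whole target.
  obtain ⟨g, hg⟩ := A.rangeRestrict.exists_rightInverse_of_surjective A.range_rangeRestrict
  obtain ⟨C, hC⟩ := LinearMap.exists_extend g
  refine ⟨C, fun v ↦ ?_⟩
  have h1 : C (A v) = g (A.rangeRestrict v) := LinearMap.congr_fun hC (A.rangeRestrict v)
  have h2 := congrArg Subtype.val (LinearMap.congr_fun hg (A.rangeRestrict v))
  rw [h1]
  exact h2

variable
  {E : Type*} [NormedAddCommGroup E] [NormedSpace ℝ E] [FiniteDimensional ℝ E]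
  {H : Type*} [TopologicalSpace H] {I : ModelWithCorners ℝ E H}
  {M : Type*} [TopologicalSpace M] [ChartedSpace H M] [IsManifold I ∞ M]
  {F : Type*} [NormedAddCommGroup F] [NormedSpace ℝ F] [FiniteDimensional ℝ F]

/-- A smooth family of endomorphisms of constant rank has, near each point, a smooth frame of its
kernel. -/
theorem exists_smooth_frame_ker {O : Set M} (hO : IsOpen O) {A : M → F →L[ℝ] F}
    (hA : ContMDiffOn I 𝓘(ℝ, F →L[ℝ] F) ∞ A O) {r : ℕ}
    (hr : ∀ y ∈ O, Module.finrank ℝ (LinearMap.ker (A y).toLinearMap) = r) {x : M} (hx : x ∈ O) :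
    ∃ U : Set M, IsOpen U ∧ x ∈ U ∧ U ⊆ O ∧ ∃ σ : Fin r → M → F,
      (∀ i, ContMDiffOn I 𝓘(ℝ, F) ∞ (σ i) U) ∧
      ∀ y ∈ U, LinearIndependent ℝ (fun i ↦ σ i y) ∧
        Submodule.span ℝ (Set.range fun i ↦ σ i y) = LinearMap.ker (A y).toLinearMap := by
  obtain ⟨C₀, hC₀⟩ := (A x).toLinearMap.exists_generalized_inverse
  set C : F →L[ℝ] F := LinearMap.toContinuousLinearMap C₀
  have hC : ∀ v, A x (C (A x v)) = A x v := hC₀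
  -- `P` projects onto `ker (A x)`, and `B y` is a perturbation of `B x = 1`. Where `B y` is
  -- invertible, it carries `ker (A y)` onto `ker (A x)`.
  set P : F →L[ℝ] F := 1 - C ∘L A x with hP
  set B : M → F →L[ℝ] F := fun y ↦ C ∘L A y + P with hB
  have hBx : B x = 1 := by simp [hB, hP]
  have hBs : ContMDiffOn I 𝓘(ℝ, F →L[ℝ] F) ∞ B O :=
    (contMDiffOn_const.clm_comp hA).add contMDiffOn_const
  have : CompleteSpace F := FiniteDimensional.complete ℝ F
  let b : Module.Basis (Fin r) ℝ (LinearMap.ker (A x).toLinearMap) :=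
    Module.finBasisOfFinrankEq ℝ _ (hr x hx)
  set n : Fin r → F := fun i ↦ b i
  have hnli : LinearIndependent ℝ n :=
    b.linearIndependent.map' (Submodule.subtype _) (Submodule.ker_subtype _)
  have hspan : ∀ v, P v ∈ Submodule.span ℝ (Set.range n) := by
    intro v
    have hv : P v ∈ LinearMap.ker (A x).toLinearMap := by
      simp [hP, hC]
    have h := Submodule.mem_map_of_mem (f := Submodule.subtype _) (b.mem_span ⟨P v, hv⟩)
    rwa [Submodule.map_span, ← Set.range_comp] at h
  -- Units form an open set in the complete algebra of endomorphisms. `Ring.inverse` is zero off the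
  -- units, but is used only on this set, where it is smooth.
  refine ⟨O ∩ B ⁻¹' {T | IsUnit T}, hBs.continuousOn.isOpen_inter_preimage hO Units.isOpen,
    ⟨hx, by simp [hBx]⟩, Set.inter_subset_left, fun i y ↦ Ring.inverse (B y) (n i),
    fun i y hy ↦ ?_, fun y hy ↦ ?_⟩
  · obtain ⟨hyO, b', hb'⟩ := hy
    have h1 : ContDiffAt ℝ ∞ Ring.inverse (B y) := hb' ▸ contDiffAt_ringInverse ℝ b'
    have h2 : ContMDiffAt I 𝓘(ℝ, F →L[ℝ] F) ∞ (fun z ↦ Ring.inverse (B z)) y :=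
      h1.contMDiffAt.comp y (hBs.contMDiffAt (hO.mem_nhds hyO))
    exact (h2.clm_apply contMDiffAt_const).contMDiffWithinAt
  · obtain ⟨hyO, b', hb'⟩ := hy
    have h := span_symm_eq_ker (A := A y) (L := C) (P := P)
      (ContinuousLinearEquiv.unitsEquiv ℝ F b')
      (fun v ↦ DFunLike.congr_fun hb' v) hnli hspan (by simpa using hr y hyO)
    have e : ∀ v, Ring.inverse (B y) v = (ContinuousLinearEquiv.unitsEquiv ℝ F b').symm v := by
      intro v
      rw [← hb', Ring.inverse_unit]
      rfl
    simpa only [e] using h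

variable
  {V : M → Type*} [TopologicalSpace (TotalSpace F V)]
  [∀ x, AddCommGroup (V x)] [∀ x, Module ℝ (V x)] [∀ x, TopologicalSpace (V x)]
  [∀ x, IsTopologicalAddGroup (V x)] [∀ x, ContinuousSMul ℝ (V x)]
  [FiberBundle F V] [VectorBundle ℝ F V] [ContMDiffVectorBundle ∞ F V I]

/-- The kernel of a smooth bundle endomorphism of constant rank is a smooth subbundle. -/
theorem isSmoothSubbundle_ker (T : Π x : M, V x →L[ℝ] V x)
    (hT_smooth : ContMDiff I (I.prod 𝓘(ℝ, F →L[ℝ] F)) ∞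
      (fun x ↦ TotalSpace.mk' (F →L[ℝ] F) (E := fun x ↦ V x →L[ℝ] V x) x (T x)))
    (hT_rank : ∃ k : ℕ, ∀ x, Module.finrank ℝ (LinearMap.range (T x).toLinearMap) = k) :
    IsSmoothSubbundle I F (fun x ↦ LinearMap.ker (T x).toLinearMap) := by
  obtain ⟨k, hk⟩ := hT_rank
  -- At any point rank–nullity gives `k ≤ finrank F`, so the truncated subtraction is the true
  -- nullity.
  refine ⟨Module.finrank ℝ F - k, fun x ↦ ?_⟩
  set e := trivializationAt F V x with he
  have hxe : x ∈ e.baseSet := FiberBundle.mem_baseSet_trivializationAt' x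
  set A : M → F →L[ℝ] F := fun y ↦ ContinuousLinearMap.inCoordinates F V F V x y x y (T y) with hA
  have hAs : ContMDiffOn I 𝓘(ℝ, F →L[ℝ] F) ∞ A e.baseSet := by
    have h := ((trivializationAt (F →L[ℝ] F) (fun y ↦ V y →L[ℝ] V y) x).contMDiffOn_section_iff
      (IB := I) (n := ∞) (s := T) e.open_baseSet (by simp [he])).1 hT_smooth.contMDiffOn
    -- The coordinate expression of `T` in the trivialization of the `Hom` bundle is `A` by
    -- definition.
    exact h
  let φ : ∀ y ∈ e.baseSet, V y ≃ₗ[ℝ] F := fun y hy ↦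
    (e.continuousLinearEquivAt ℝ y hy).toLinearEquiv
  have hAφ : ∀ y (hy : y ∈ e.baseSet), (A y).toLinearMap =
      (φ y hy).toLinearMap ∘ₗ (T y).toLinearMap ∘ₗ (φ y hy).symm.toLinearMap := by
    intro y hy
    ext v
    simp only [hA, ContinuousLinearMap.inCoordinates_eq (x₀ := x) (y₀ := x) hy hy]
    rfl
  have hker : ∀ y (hy : y ∈ e.baseSet), LinearMap.ker (A y).toLinearMap =
      (LinearMap.ker (T y).toLinearMap).map (φ y hy).toLinearMap := by
    intro y hy
    rw [hAφ y hy, LinearEquiv.ker_comp, LinearMap.ker_comp, ← Submodule.map_equiv_eq_comap_symm]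
  have hr : ∀ y ∈ e.baseSet,
      Module.finrank ℝ (LinearMap.ker (A y).toLinearMap) = Module.finrank ℝ F - k := by
    intro y hy
    have : FiniteDimensional ℝ (V y) := (φ y hy).symm.finiteDimensional
    have h1 := LinearMap.finrank_range_add_finrank_ker (T y).toLinearMap
    rw [hk, (φ y hy).finrank_eq] at h1
    rw [hker y hy, LinearEquiv.finrank_map_eq]
    omega
  obtain ⟨U, hU, hxU, hUe, σ, hσ, hσU⟩ := exists_smooth_frame_ker e.open_baseSet hAs hr hxe
  refine ⟨U, hU, hxU, fun i y ↦ e.symm y (σ i y), fun i ↦ ?_, fun y hy ↦ ?_⟩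
  · rw [e.contMDiffOn_section_iff hU hUe]
    refine (hσ i).congr fun y hy ↦ ?_
    rw [e.apply_mk_symm (hUe hy)]
  · have hye := hUe hy
    have hφ : (fun i ↦ e.symm y (σ i y)) = (φ y hye).symm ∘ fun i ↦ σ i y := rfl
    refine ⟨?_, ?_⟩
    · rw [hφ]
      exact (hσU y hy).1.map' (φ y hye).symm.toLinearMap (φ y hye).symm.ker
    · rw [hφ, Set.range_comp]
      have := congrArg (Submodule.map (φ y hye).symm.toLinearMap) (hσU y hy).2
      rw [Submodule.map_span, hker y hye, ← Submodule.map_comp] at this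
      simpa using this

end ConstantRank
theorem mainTheorem11
    {E : Type*} [NormedAddCommGroup E] [NormedSpace ℝ E] [FiniteDimensional ℝ E]
    {H : Type*} [TopologicalSpace H] {I : ModelWithCorners ℝ E H} [I.Boundaryless]
    {M : Type*} [TopologicalSpace M] [T2Space M] [ChartedSpace H M] [IsManifold I ∞ M]
    [RiemannianBundle (fun x : M ↦ TangentSpace I x)]
    [IsContMDiffRiemannianBundle I ∞ E (fun x : M ↦ TangentSpace I x)]
    (nablaM : CovariantDerivative I E (fun x : M ↦ TangentSpace I x))
    (hM : IsLeviCivita nablaM)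
    {F : Type*} [NormedAddCommGroup F] [NormedSpace ℝ F] [FiniteDimensional ℝ F]
    {V : M → Type*} [TopologicalSpace (TotalSpace F V)]
    [∀ x, NormedAddCommGroup (V x)] [∀ x, InnerProductSpace ℝ (V x)]
    [FiberBundle F V] [VectorBundle ℝ F V] [ContMDiffVectorBundle ∞ F V I]
    [IsContMDiffRiemannianBundle I ∞ F V]
    (nabla : CovariantDerivative I F V) [nabla.ContMDiffCovariantDerivative ∞]
    (h_metric : nabla.IsMetricCompatible)
    (X : Π x : M, TangentSpace I x)
    (T : Π x : M, V x →L[ℝ] V x)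
    (hT_smooth : ContMDiff I (I.prod 𝓘(ℝ, F →L[ℝ] F)) ∞
      (fun x ↦ TotalSpace.mk' (F →L[ℝ] F) (E := fun x ↦ V x →L[ℝ] V x) x (T x)))
    (hT_rank : ∃ k : ℕ, ∀ x, Module.finrank ℝ (LinearMap.range (T x).toLinearMap) = k)
    (hT_symm : ∀ (x : M) (v w : V x), inner ℝ (T x v) w = inner ℝ v (T x w))
    (hT_nonneg : ∀ (x : M) (v : V x), 0 ≤ inner ℝ (T x v) v)
    (hT_laplacian : ∀ (x : M) (v : V x), T x v = 0 →
      inner ℝ (XLaplacian nablaM (nabla.hom nabla) X T x v) v ≤ 0) :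
    IsSmoothSubbundle I F (fun x ↦ LinearMap.ker (T x).toLinearMap) ∧
      IsParallelSubspace nabla (fun x ↦ LinearMap.ker (T x).toLinearMap) := by
  exact ⟨isSmoothSubbundle_ker T hT_smooth hT_rank,
    isParallelSubspace_ker nablaM nabla h_metric X T hT_smooth hT_symm hT_nonneg hT_laplacian⟩
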